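/- Let $T\ge 1$ and let $p_0(t),p_1(t),p_2(t)>0$ $(t=1,\dots,T)$; put $\widehat p_i(t)=p_i(t)/p_0(t)$, $i=1,2$. For $\rho\in[-1,0)\cup(0,+\infty)$ put $$\widetilde p_i(t,\rho)=\widehat p_i(t)^{-\rho}\ \text{ if }\rho<0,\qquad \widetilde p_i(t,\rho)=\tfrac1\varepsilon-\widehat p_i(t)^{-\rho}\ \text{ if }\rho>0,$$ where, for $\rho>0$, $\varepsilon=\varepsilon(\rho)>0$ is any number such that $\widehat p_i(t)^{-\rho}<\tfrac1\varepsilon$ for all $i,t$. Consider the lines $$\widetilde p_1(t,\rho)z_1+\widetilde p_2(t,\rho)z_2=1\qquad(t=1,\dots,T)\tag{1}$$ in $\mathbb R^2_+=\{z_1\ge0,\ z_2\ge0\}$ and the rays $R_\alpha=\{z\in\mathbb R^2_+ : z_2=z_1\tan\alpha\}$, $\alpha\in(0,\frac\pi2)$. We say that $\rho$ is generic if no three of the lines (1) have a common point in $\mathbb R^2_+$ and each $R_\alpha$ meets at most one point of $\mathbb R^2_+$ that lies on two different lines (1). For generic $\rho$ let $0=\alpha_0<\alpha_1<\dots<\alpha_N<\alpha_{N+1}=\frac\pi2$,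 where $\alpha_1,\dots,\alpha_N$ are all the $\alpha\in(0,\frac\pi2)$ for which $R_\alpha$ meets an intersection point of two lines (1). For $\alpha\in(0,\frac\pi2)\setminus\{\alpha_1,\dots,\alpha_N\}$ let $\pi(\alpha)=(\pi_1(\alpha),\dots,\pi_T(\alpha))$ be the order in which the lines (1) are met when $R_\alpha$ is traversed from $z_1=+\infty$ to $z_1=0$. The formal word of the partition of $\mathbb R^2_+$ by the lines (1) is $\omega=\sigma_{t_1}\cdots\sigma_{t_N}$ (empty if $N=0$), where $\sigma_t=(t,t+1)$, $1\le t\le T-1$, and $t_i$ is such that, when $\alpha$ crosses $\alpha_i$, the sequence $\pi(\alpha)$ changes by interchanging its entries at the positions $t_i$ and $t_i+1$. A word is considered as a permutation by multiplying its letters, where permutations are composed as functions: $(\sigma\tau)(k)=\sigma(\tau(k))$. Fix $\rho\in[-1,0)\cup(0,+\infty)$, assume that the time series is numbered so that $\widetilde p_1(1,\rho)<\dots<\widetilde p_1(T,\rho)$, and let $\Sigma_\rho\in S_T$ be a permutation such that $\widetilde p_2(\Sigma_\rho(1),\rho)<\dots<\widetilde p_2(\Sigma_\rho(T),\rho)$.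 **Proposition.** Let $\rho_1,\rho_2\in[-1,0)\cup(0,+\infty)$ be generic, and let $\omega_1=\sigma_{i_1}\cdots\sigma_{i_k}$ and $\omega_2=\sigma_{j_1}\cdots\sigma_{j_m}$ be the formal words of the partitions corresponding to $\rho_1$ and $\rho_2$, respectively. If $\omega_1$ and $\omega_2$, considered as permutations, are equal to $\Sigma_\rho$, then they can be transformed one into another by a finite number of moves, each replacing a subword according to $$\sigma_{s}\sigma_{t}\leftrightarrow\sigma_{t}\sigma_{s}\quad(|s-t|\ge2),\qquad \sigma_t\sigma_{t+1}\sigma_t\leftrightarrow\sigma_{t+1}\sigma_t\sigma_{t+1}\quad(1\le t\le T-2).$$ -/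

import Mathlib

namespace CESPartition

/-- The transformed price series `t ↦ p̃ᵢ(t, ρ)` computed from the output prices `p₀(t)` and the
prices `pᵢ(t)` of one production factor: with `p̂ᵢ = pᵢ / p₀` it is `p̂ᵢ ^ (-ρ)` for `ρ < 0` and
`1 / ε - p̂ᵢ ^ (-ρ)` for `ρ > 0`. -/
noncomputable def ptilde {n : ℕ} (ε ρ : ℝ) (p₀ p : Fin (n + 1) → ℝ) (t : Fin (n + 1)) : ℝ :=
  if ρ < 0 then (p t / p₀ t) ^ (-ρ) else 1 / ε - (p t / p₀ t) ^ (-ρ)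

/-- The range `[-1, 0) ∪ (0, +∞)` of the parameter `ρ`. -/
def paramRange : Set ℝ := Set.Ico (-1) 0 ∪ Set.Ioi 0

/-- The admissible `ε` in the change of variables for `ρ > 0` (there is no condition for `ρ < 0`,
where `ε` is not used): `ε > 0` and `p̂ᵢ(t) ^ (-ρ) < 1 / ε` for `i = 1, 2` and all `t`. This implies
that the unit cost `(∑ᵢ p̂ᵢ(t) ^ (-ρ) * xᵢ ^ (-ρ)) ^ (-1 / ρ)` exceeds `1` for all `x₁, x₂ > 0`
with `x₁ ^ (-ρ) + x₂ ^ (-ρ) ≤ ε`. -/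
def EpsAdmissible {n : ℕ} (ε ρ : ℝ) (p₀ p₁ p₂ : Fin (n + 1) → ℝ) : Prop :=
  0 < ρ → 0 < ε ∧ ∀ t, (p₁ t / p₀ t) ^ (-ρ) < 1 / ε ∧ (p₂ t / p₀ t) ^ (-ρ) < 1 / ε

/-- The closed quadrant `ℝ²₊`. -/
def quadrant : Set (ℝ × ℝ) := {z | 0 ≤ z.1 ∧ 0 ≤ z.2}

/-- The `t`-th line `a(t) z₁ + b(t) z₂ = 1`. -/
def line {n : ℕ} (a b : Fin (n + 1) → ℝ) (t : Fin (n + 1)) : Set (ℝ × ℝ) :=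
  {z | a t * z.1 + b t * z.2 = 1}

/-- The ray `R_α = {z ∈ ℝ²₊ | z₂ = z₁ tan α}`. -/
def ray (α : ℝ) : Set (ℝ × ℝ) := {z | z ∈ quadrant ∧ z.2 = z.1 * Real.tan α}

/-- The points of `ℝ²₊` which lie on two different lines of the family. -/
def crossings {n : ℕ} (a b : Fin (n + 1) → ℝ) : Set (ℝ × ℝ) :=
  {z | z ∈ quadrant ∧ ∃ s t, s ≠ t ∧ z ∈ line a b s ∧ z ∈ line a b t}

/-- General position of the partition of `ℝ²₊` by the lines: no three lines have a common point,
and each ray `R_α` meets at most one crossing. -/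
structure GeneralPosition {n : ℕ} (a b : Fin (n + 1) → ℝ) : Prop where
  no_triple : ∀ r s t : Fin (n + 1), r ≠ s → r ≠ t → s ≠ t →
    ¬ ∃ z ∈ quadrant, z ∈ line a b r ∧ z ∈ line a b s ∧ z ∈ line a b t
  ray_simple : ∀ α ∈ Set.Ioo 0 (Real.pi / 2), (ray α ∩ crossings a b).Subsingleton

/-- The angles `α ∈ (0, π/2)` such that the ray `R_α` meets a crossing. -/
def criticalAngles {n : ℕ} (a b : Fin (n + 1) → ℝ) : Set ℝ :=
  {α | α ∈ Set.Ioo 0 (Real.pi / 2) ∧ (ray α ∩ crossings a b).Nonempty}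

/-- `π` is the order in which a point running along `R_α` from `z₁ = +∞` to `z₁ = 0` meets the
lines: if `z(t)` is the point where `R_α` meets the `t`-th line, then
`z₁(π(1)) > z₁(π(2)) > ⋯ > z₁(π(T))`. -/
def IsRayOrder {n : ℕ} (a b : Fin (n + 1) → ℝ) (α : ℝ) (π : Equiv.Perm (Fin (n + 1))) : Prop :=
  ∃ z : Fin (n + 1) → ℝ × ℝ,
    (∀ t, ray α ∩ line a b t = {z t}) ∧ StrictAnti fun k => (z (π k)).1

/-- The elementary transposition `σ_i = (i, i + 1)`, `1 ≤ i ≤ T - 1` (here `T = n + 1`, and both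
positions and letters are numbered from `0`). -/
def sigma {n : ℕ} (i : Fin n) : Equiv.Perm (Fin (n + 1)) := Equiv.swap i.castSucc i.succ

/-- A formal word in the elementary transpositions, considered as a permutation. -/
def wordPerm {n : ℕ} (ω : List (Fin n)) : Equiv.Perm (Fin (n + 1)) := (ω.map sigma).prod

/-- `ω = σ_{t₁} ⋯ σ_{t_N}` is the formal word of the partition of `ℝ²₊` by the lines:
`α₁ < ⋯ < α_N` are the critical angles, `α₀ = 0`, `α_{N+1} = π/2`, and when `α` crosses `α_i` the
entries at the positions `t_i`, `t_i + 1` of the order `(π₁(α), …, π_T(α))` are interchanged.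
(Interchanging two positions is multiplication by the transposition on the right when permutations
are composed as functions; `ang i` is `α_i`, and `ω[i]` is the letter number `i + 1`.) -/
def IsFormalWord {n : ℕ} (a b : Fin (n + 1) → ℝ) (ω : List (Fin n)) : Prop :=
  ∃ ang : ℕ → ℝ,
    ang 0 = 0 ∧ ang (ω.length + 1) = Real.pi / 2 ∧
    (∀ i ≤ ω.length, ang i < ang (i + 1)) ∧
    criticalAngles a b = {α | ∃ i, 1 ≤ i ∧ i ≤ ω.length ∧ ang i = α} ∧
    ∀ (i : ℕ) (hi : i < ω.length),
      ∀ α ∈ Set.Ioo (ang i) (ang (i + 1)), ∀ β ∈ Set.Ioo (ang (i + 1)) (ang (i + 2)),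
        ∃ π, IsRayOrder a b α π ∧ IsRayOrder a b β (π * sigma ω[i])

/-- A single 2-braid or 3-braid move applied to a subword of a formal word. -/
inductive BraidMove {n : ℕ} : List (Fin n) → List (Fin n) → Prop
  | two (u v : List (Fin n)) (i j : Fin n) (h : (i : ℕ) + 2 ≤ j ∨ (j : ℕ) + 2 ≤ i) :
      BraidMove (u ++ [i, j] ++ v) (u ++ [j, i] ++ v)
  | three (u v : List (Fin n)) (i j : Fin n) (h : (j : ℕ) = i + 1 ∨ (i : ℕ) = j + 1) :
      BraidMove (u ++ [i, j, i] ++ v) (u ++ [j, i, j] ++ v)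

end CESPartition

/-!
The formal word of a partition is a reduced word, and two reduced words of one permutation are
related by braid moves (the theorem of Matsumoto and Tits for the symmetric group).

*Reducedness.* Along the ray `R_α` the `t`-th line is met at `z₁ = 1 / (a t + b t * tan α)`, so the
ray order `π(α)` sorts the lines by the increasing value of a function which is affine in `tan α`.
The difference of two affine functions changes its sign at most once, so two lines that are
interchanged at a critical angle are never interchanged at another one. Hence each letter of the
word interchanges two entries which are still in their original order, and the word is reduced
(`IsFormalWord.isReduced`).

*Braid moves.* Let `u i` and `v j` be reduced words of the same permutation `w`, with `i ≠ j`. Then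
`w` has descents at `i` and `j`, so it has a reduced word whose end is a reduced word of the longest
element of the subgroup generated by `σ_i` and `σ_j`. This element can be written both with last letter `i` and
with last letter `j`, and the two ways differ by one braid move. Induction on the length handles
the remaining letters (`IsReduced.braid_equivalent`).
-/

namespace CESPartition

open Relation

/-! ### Words as permutations, and braid equivalence -/

lemma wordPerm_append {n : ℕ} (u v : List (Fin n)) :
    wordPerm (u ++ v) = wordPerm u * wordPerm v := by
  simp [wordPerm]

lemma wordPerm_singleton {n : ℕ} (i : Fin n) : wordPerm [i] = sigma i := by
  simp [wordPerm]

lemma sigma_mul_self {n : ℕ} (i : Fin n) : sigma i * sigma i = 1 :=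
  Equiv.swap_mul_self _ _

lemma sigma_castSucc {n : ℕ} (i : Fin n) : sigma i i.castSucc = i.succ :=
  Equiv.swap_apply_left _ _

lemma sigma_succ {n : ℕ} (i : Fin n) : sigma i i.succ = i.castSucc :=
  Equiv.swap_apply_right _ _

lemma sigma_of_ne {n : ℕ} {i : Fin n} {k : Fin (n + 1)} (h₁ : (k : ℕ) ≠ i)
    (h₂ : (k : ℕ) ≠ i + 1) : sigma i k = k :=
  Equiv.swap_apply_of_ne_of_ne (fun h => h₁ (by simp [h])) (fun h => h₂ (by simp [h]))

lemma BraidMove.symm {n : ℕ} {u v : List (Fin n)} (h : BraidMove u v) : BraidMove v u := by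
  cases h with
  | two u v i j h => exact .two u v j i h.symm
  | three u v i j h => exact .three u v j i h.symm

lemma BraidMove.append_right {n : ℕ} {u v : List (Fin n)} (h : BraidMove u v)
    (x : List (Fin n)) : BraidMove (u ++ x) (v ++ x) := by
  cases h with
  | two u v i j h => simpa using BraidMove.two u (v ++ x) i j h
  | three u v i j h => simpa using BraidMove.three u (v ++ x) i j h

lemma BraidMove.length_eq {n : ℕ} {u v : List (Fin n)} (h : BraidMove u v) :
    u.length = v.length := by
  cases h <;> simp

lemma braid_symm {n : ℕ} {u v : List (Fin n)} (h : ReflTransGen BraidMove u v) :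
    ReflTransGen BraidMove v u := by
  induction h with
  | refl => exact .refl
  | tail _ h ih => exact ih.head h.symm

lemma braid_append_right {n : ℕ} {u v : List (Fin n)} (h : ReflTransGen BraidMove u v)
    (x : List (Fin n)) : ReflTransGen BraidMove (u ++ x) (v ++ x) :=
  h.lift (· ++ x) fun _ _ h => h.append_right x

lemma braid_length_eq {n : ℕ} {u v : List (Fin n)} (h : ReflTransGen BraidMove u v) :
    u.length = v.length := by
  induction h with
  | refl => rfl
  | tail _ h ih => exact ih.trans h.length_eq

/-! ### Reduced words -/

/-- A word is reduced if each letter `i` is applied at an ascent of the permutation `w` of the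
letters before it, i.e. `w (i) < w (i + 1)`, so that it creates a new inversion. -/
inductive IsReduced {n : ℕ} : List (Fin n) → Prop
  | nil : IsReduced []
  | snoc (u : List (Fin n)) (i : Fin n) (hu : IsReduced u)
      (h : wordPerm u i.castSucc < wordPerm u i.succ) : IsReduced (u ++ [i])

lemma IsReduced.of_snoc {n : ℕ} {u : List (Fin n)} {i : Fin n} (h : IsReduced (u ++ [i])) :
    IsReduced u ∧ wordPerm u i.castSucc < wordPerm u i.succ := by
  generalize hx : u ++ [i] = x at h
  cases h with
  | nil => simp at hx
  | snoc v j hv hj =>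
    obtain ⟨rfl, h⟩ := List.append_inj' hx rfl
    obtain rfl : i = j := by simpa using h
    exact ⟨hv, hj⟩

/-- The permutation of a reduced word has a descent at the last letter. -/
lemma IsReduced.descent {n : ℕ} {u : List (Fin n)} {i : Fin n} (h : IsReduced (u ++ [i])) :
    wordPerm (u ++ [i]) i.succ < wordPerm (u ++ [i]) i.castSucc := by
  simpa [wordPerm_append, wordPerm_singleton, sigma_castSucc, sigma_succ] using h.of_snoc.2

lemma eq_one_of_no_descent {n : ℕ} (w : Equiv.Perm (Fin (n + 1)))
    (h : ∀ i : Fin n, w i.castSucc ≤ w i.succ) : w = 1 := by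
  have hm : Monotone w := Fin.monotone_iff_le_succ.2 h
  have h1 := Tuple.unique_monotone (f := id) (σ := w) (τ := 1) hm monotone_id
  exact Equiv.ext fun k => congrFun h1 k

/-- Removing a descent lowers a permutation in the lexicographic order of its values, so descents
can be removed until the identity is reached. -/
lemma exists_isReduced {n : ℕ} (w : Equiv.Perm (Fin (n + 1))) :
    ∃ u, IsReduced u ∧ wordPerm u = w := by
  have wf : WellFounded fun v w : Equiv.Perm (Fin (n + 1)) => toLex ⇑v < toLex ⇑w :=
    InvImage.wf (fun w : Equiv.Perm (Fin (n + 1)) => toLex ⇑w) wellFounded_lt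
  induction w using wf.induction with
  | _ w ih =>
    by_cases h : ∀ i : Fin n, w i.castSucc ≤ w i.succ
    · exact ⟨[], .nil, (eq_one_of_no_descent w h).symm⟩
    · push Not at h
      obtain ⟨i, hi⟩ := h
      obtain ⟨u, hu, hw⟩ := ih (w * sigma i)
        (Pi.lex_desc (f := ⇑w) (Fin.castSucc_lt_succ (i := i)).le hi)
      refine ⟨u ++ [i], .snoc u i hu ?_, ?_⟩
      · simpa [hw, sigma_castSucc, sigma_succ] using hi
      · rw [wordPerm_append, wordPerm_singleton, hw, mul_assoc, sigma_mul_self, mul_one]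

/-! ### Braid equivalence of reduced words -/

/-- If `w` has descents at two distant positions `i` and `j`, then it has reduced words ending
in `i j` and in `j i`. -/
lemma exists_isReduced_two {n : ℕ} (w : Equiv.Perm (Fin (n + 1))) {i j : Fin n}
    (hij : (i : ℕ) + 2 ≤ j ∨ (j : ℕ) + 2 ≤ i) (hi : w i.succ < w i.castSucc)
    (hj : w j.succ < w j.castSucc) :
    ∃ r, IsReduced (r ++ [i]) ∧ IsReduced (r ++ [j]) ∧
      wordPerm (r ++ [i]) = w * sigma j ∧ wordPerm (r ++ [j]) = w * sigma i := by
  have e1 : sigma i j.castSucc = j.castSucc := sigma_of_ne (by simp; omega) (by simp; omega)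
  have e2 : sigma i j.succ = j.succ := sigma_of_ne (by simp; omega) (by simp; omega)
  have e3 : sigma j i.castSucc = i.castSucc := sigma_of_ne (by simp; omega) (by simp; omega)
  have e4 : sigma j i.succ = i.succ := sigma_of_ne (by simp; omega) (by simp; omega)
  have comm : sigma i * sigma j = sigma j * sigma i := by
    have h := Equiv.swap_mul_eq_mul_swap (sigma i) j.castSucc j.succ
    have hs : (sigma i)⁻¹ = sigma i := Equiv.swap_inv _ _
    rw [hs, e1, e2] at h
    exact h.symm
  obtain ⟨r, hr, hw⟩ := exists_isReduced (w * sigma i * sigma j)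
  refine ⟨r, .snoc r i hr ?_, .snoc r j hr ?_, ?_, ?_⟩
  · simpa [hw, e3, e4, sigma_castSucc, sigma_succ] using hi
  · simpa [hw, e1, e2, sigma_castSucc, sigma_succ] using hj
  · rw [wordPerm_append, wordPerm_singleton, hw, mul_assoc w, comm, mul_assoc, mul_assoc,
      sigma_mul_self, mul_one]
  · rw [wordPerm_append, wordPerm_singleton, hw, mul_assoc, sigma_mul_self, mul_one]

/-- If `w` has descents at two neighbouring positions `i` and `j = i + 1`, then it has reduced
words ending in `i j i` and in `j i j`. -/
lemma exists_isReduced_three {n : ℕ} (w : Equiv.Perm (Fin (n + 1))) {i j : Fin n}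
    (hij : (j : ℕ) = i + 1) (hi : w i.succ < w i.castSucc)
    (hj : w j.succ < w j.castSucc) :
    ∃ r, IsReduced (r ++ [i, j]) ∧ IsReduced (r ++ [j, i]) ∧
      wordPerm (r ++ [i, j]) = w * sigma i ∧ wordPerm (r ++ [j, i]) = w * sigma j := by
  have e0 : j.castSucc = i.succ := Fin.ext (by simp [hij])
  have e1 : sigma i j.succ = j.succ := sigma_of_ne (by simp; omega) (by simp; omega)
  have e2 : sigma j i.castSucc = i.castSucc := sigma_of_ne (by simp; omega) (by simp; omega)
  have e3 : sigma j i.succ = j.succ := e0 ▸ sigma_castSucc j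
  have e4 : sigma j j.succ = i.succ := e0 ▸ sigma_succ j
  have si := sigma_castSucc i
  have si' := sigma_succ i
  -- Both sides are the transposition of `i` and `i + 2`, as conjugates.
  have braid : sigma i * sigma j * sigma i = sigma j * sigma i * sigma j := by
    have h1 := Equiv.mul_swap_eq_swap_mul (sigma i) j.castSucc j.succ
    have h2 := Equiv.mul_swap_eq_swap_mul (sigma j) i.castSucc i.succ
    rw [e1, e0, si'] at h1
    rw [e2, e3] at h2
    have h1' : sigma i * sigma j = Equiv.swap i.castSucc j.succ * sigma i := by
      rw [← h1, ← e0]; rfl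
    have h2' : sigma j * sigma i = Equiv.swap i.castSucc j.succ * sigma j := h2
    rw [h1', h2', mul_assoc, mul_assoc, sigma_mul_self, sigma_mul_self]
  rw [e0] at hj
  obtain ⟨r, hr, hw⟩ := exists_isReduced (w * (sigma i * sigma j * sigma i))
  have hri : IsReduced (r ++ [i]) := .snoc r i hr (by
    simpa [hw, si, si', e1, e2, e3, e4] using hj)
  have hrj : IsReduced (r ++ [j]) := .snoc r j hr (by
    simpa [hw, e0, si, si', e1, e2, e3, e4] using hi)
  have hwi : wordPerm (r ++ [i]) = w * sigma i * sigma j := by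
    rw [wordPerm_append, wordPerm_singleton, hw]
    simp only [mul_assoc, sigma_mul_self, mul_one]
  have hwj : wordPerm (r ++ [j]) = w * sigma j * sigma i := by
    rw [wordPerm_append, wordPerm_singleton, hw, braid]
    simp only [mul_assoc, sigma_mul_self, mul_one]
  have h1 : r ++ [i, j] = (r ++ [i]) ++ [j] := by simp
  have h2 : r ++ [j, i] = (r ++ [j]) ++ [i] := by simp
  refine ⟨r, ?_⟩
  rw [h1, h2]
  refine ⟨.snoc _ j hri ?_, .snoc _ i hrj ?_, ?_, ?_⟩
  · simpa [hwi, e0, si, si', e1, e2, e3, e4] using hi.trans' hj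
  · simpa [hwj, si, si', e1, e2, e3, e4] using hi.trans' hj
  · rw [wordPerm_append, wordPerm_singleton, hwi, mul_assoc, sigma_mul_self, mul_one]
  · rw [wordPerm_append, wordPerm_singleton, hwj, mul_assoc, sigma_mul_self, mul_one]

/-- **Matsumoto's theorem** for the symmetric group: two reduced words of the same permutation are
related by braid moves. -/
theorem IsReduced.braid_equivalent {n : ℕ} {u v : List (Fin n)} (hu : IsReduced u)
    (hv : IsReduced v) (h : wordPerm u = wordPerm v) : ReflTransGen BraidMove u v := by
  induction hN : u.length generalizing u v with
  | zero =>
    obtain rfl := List.length_eq_zero_iff.1 hN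
    cases hv with
    | nil => exact .refl
    | snoc v j hv hj =>
      have hd := (IsReduced.snoc v j hv hj).descent
      rw [← h] at hd
      exact absurd hd (Fin.castSucc_lt_succ (i := j)).not_gt
  | succ N ih =>
    cases hu with
    | nil => simp at hN
    | snoc u i hu hui =>
    have hui' := (IsReduced.snoc u i hu hui).descent
    cases hv with
    | nil =>
      rw [h] at hui'
      exact absurd hui' (Fin.castSucc_lt_succ (i := i)).not_gt
    | snoc v j hv hvj =>
      have hvj' := (IsReduced.snoc v j hv hvj).descent
      rw [← h] at hvj'
      have hlen : u.length = N := by simpa using hN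
      have hpu : wordPerm u = wordPerm (u ++ [i]) * sigma i := by
        rw [wordPerm_append, wordPerm_singleton, mul_assoc, sigma_mul_self, mul_one]
      have hpv : wordPerm v = wordPerm (u ++ [i]) * sigma j := by
        rw [h, wordPerm_append, wordPerm_singleton, mul_assoc, sigma_mul_self, mul_one]
      -- It is enough to find reduced words `x` and `y` of the shortened permutations
      -- for which `x i` and `y j` differ by one braid move.
      have key : ∀ x y : List (Fin n), IsReduced x → IsReduced y →
          wordPerm x = wordPerm (u ++ [i]) * sigma i →
          wordPerm y = wordPerm (u ++ [i]) * sigma j →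
          BraidMove (x ++ [i]) (y ++ [j]) → ReflTransGen BraidMove (u ++ [i]) (v ++ [j]) := by
        intro x y hx hy hpx hpy hxy
        have h1 : ReflTransGen BraidMove u x := ih hu hx (hpu.trans hpx.symm) hlen
        have hly : y.length = N := by
          have h2 := hxy.length_eq
          have h3 := braid_length_eq h1
          simp only [List.length_append, List.length_singleton] at h2
          omega
        have h2 : ReflTransGen BraidMove y v := ih hy hv (hpy.trans hpv.symm) hly
        exact (braid_append_right h1 [i]).trans
          ((ReflTransGen.single hxy).trans (braid_append_right h2 [j]))
      by_cases hij : i = j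
      · subst hij
        exact braid_append_right (ih hu hv (hpu.trans hpv.symm) hlen) [i]
      have hij' : (i : ℕ) ≠ j := fun e => hij (Fin.ext e)
      by_cases hfar : (i : ℕ) + 2 ≤ j ∨ (j : ℕ) + 2 ≤ i
      · obtain ⟨r, h1, h2, h3, h4⟩ := exists_isReduced_two _ hfar hui' hvj'
        exact key _ _ h2 h1 h4 h3 (by simpa using BraidMove.two r [] j i hfar.symm)
      · have hnear : (j : ℕ) = i + 1 ∨ (i : ℕ) = j + 1 := by omega
        rcases hnear with hn | hn
        · obtain ⟨r, h1, h2, h3, h4⟩ := exists_isReduced_three _ hn hui' hvj'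
          exact key _ _ h1 h2 h3 h4 (by simpa using BraidMove.three r [] i j (.inl hn))
        · obtain ⟨r, h1, h2, h3, h4⟩ := exists_isReduced_three _ hn hvj' hui'
          exact key _ _ h2 h1 h4 h3 (by simpa using BraidMove.three r [] i j (.inr hn))

/-! ### Ray orders and formal words -/

/-- A ray order sorts the lines by the increasing values of `a t + b t * tan α`, which are the
inverses of the abscissas of the points where the ray meets the lines. -/
lemma IsRayOrder.strictMono {n : ℕ} {a b : Fin (n + 1) → ℝ} {α : ℝ}
    {π : Equiv.Perm (Fin (n + 1))} (h : IsRayOrder a b α π) :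
    StrictMono fun k => a (π k) + b (π k) * Real.tan α := by
  obtain ⟨z, hz, hanti⟩ := h
  have hinv : ∀ t, (z t).1 * (a t + b t * Real.tan α) = 1 ∧ 0 < (z t).1 := by
    intro t
    have hm : z t ∈ ray α ∩ line a b t := by rw [hz t]; rfl
    obtain ⟨⟨⟨h1, -⟩, h2⟩, h3⟩ := hm
    have h3' : a t * (z t).1 + b t * (z t).2 = 1 := h3
    have h4 : (z t).1 * (a t + b t * Real.tan α) = 1 := by rw [h2] at h3'; linarith
    refine ⟨h4, lt_of_le_of_ne h1 fun h0 => ?_⟩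
    rw [← h0, zero_mul] at h4
    exact zero_ne_one h4
  intro k l hkl
  obtain ⟨e1, p1⟩ := hinv (π k)
  obtain ⟨e2, p2⟩ := hinv (π l)
  have hlt : (z (π l)).1 < (z (π k)).1 := hanti hkl
  have h1 : a (π k) + b (π k) * Real.tan α = (z (π k)).1⁻¹ := eq_inv_of_mul_eq_one_right e1
  have h2 : a (π l) + b (π l) * Real.tan α = (z (π l)).1⁻¹ := eq_inv_of_mul_eq_one_right e2
  change a (π k) + b (π k) * Real.tan α < a (π l) + b (π l) * Real.tan α
  rw [h1, h2]
  exact (inv_lt_inv₀ p1 p2).2 hlt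

lemma IsRayOrder.unique {n : ℕ} {a b : Fin (n + 1) → ℝ} {α : ℝ}
    {π π' : Equiv.Perm (Fin (n + 1))} (h : IsRayOrder a b α π) (h' : IsRayOrder a b α π') :
    π = π' := by
  let f : Fin (n + 1) → ℝ := fun t => a t + b t * Real.tan α
  have hm : StrictMono (f ∘ π) := h.strictMono
  have hm' : StrictMono (f ∘ π') := h'.strictMono
  have he : f ∘ π = f ∘ π' := Tuple.unique_monotone hm.monotone hm'.monotone
  have hf : Function.Injective f := (Equiv.injective_comp π f).1 hm.injective
  exact Equiv.ext fun k => hf (congrFun he k)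

/-- An affine function cannot be nonpositive, then positive, then negative. -/
lemma affine_no_two_sign_changes {c m x y z : ℝ} (hxy : x ≤ y) (hyz : y < z)
    (hx : c + m * x ≤ 0) (hy : 0 < c + m * y) (hz : c + m * z < 0) : False := by
  have hm : m < 0 := by
    by_contra hm
    have := mul_le_mul_of_nonneg_left hyz.le (not_lt.1 hm)
    linarith
  have := mul_le_mul_of_nonpos_left hxy hm.le
  linarith

/-- The formal word of a partition is reduced: any two lines are interchanged at most once. -/
theorem IsFormalWord.isReduced {n : ℕ} {a b : Fin (n + 1) → ℝ} {ω : List (Fin n)}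
    (h : IsFormalWord a b ω) : IsReduced ω := by
  obtain ⟨ang, h0, hlast, hlt, -, hstep⟩ := h
  rcases Nat.eq_zero_or_pos ω.length with hN | hN
  · rw [List.length_eq_zero_iff.1 hN]
    exact .nil
  have hmono : ∀ i j, i ≤ j → j ≤ ω.length + 1 → ang i ≤ ang j := by
    intro i j hij
    induction j, hij using Nat.le_induction with
    | base => exact fun _ => le_rfl
    | succ j _ ih => exact fun hj => (ih (by omega)).trans (hlt j (by omega)).le
  -- Sample the ray order once in each interval between consecutive critical angles.
  let x : ℕ → ℝ := fun i => (ang i + ang (i + 1)) / 2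
  have hx : ∀ i ≤ ω.length, x i ∈ Set.Ioo (ang i) (ang (i + 1)) := fun i hi =>
    ⟨left_lt_add_div_two.2 (hlt i hi), add_div_two_lt_right.2 (hlt i hi)⟩
  have hxlt : ∀ i < ω.length, x i < x (i + 1) := fun i hi =>
    (hx i hi.le).2.trans (hx (i + 1) hi).1
  have hx0 : ∀ i ≤ ω.length, x 0 ≤ x i := by
    intro i
    induction i with
    | zero => exact fun _ => le_rfl
    | succ i ih => exact fun hi => (ih (by omega)).trans (hxlt i hi).le
  have hrange : ∀ i ≤ ω.length, x i ∈ Set.Ioo (-(Real.pi / 2)) (Real.pi / 2) := by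
    intro i hi
    have h1 := hmono 0 i (by omega) (by omega)
    have h2 := hmono (i + 1) (ω.length + 1) (by omega) le_rfl
    have h3 := hx i hi
    have h4 := Real.pi_pos
    rw [h0] at h1
    rw [hlast] at h2
    exact ⟨by linarith [h3.1], h3.2.trans_le h2⟩
  have htan := Real.strictMonoOn_tan
  obtain ⟨π₀, hπ₀, -⟩ := hstep 0 hN (x 0) (hx 0 (by omega)) (x 1) (hx 1 hN)
  have main : ∀ k ≤ ω.length,
      IsReduced (ω.take k) ∧ IsRayOrder a b (x k) (π₀ * wordPerm (ω.take k)) := by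
    intro k
    induction k with
    | zero => exact fun _ => ⟨by simpa using IsReduced.nil, by simpa [wordPerm] using hπ₀⟩
    | succ k ih =>
      intro hk
      obtain ⟨hred, hord⟩ := ih (by omega)
      obtain ⟨π, h1, h2⟩ := hstep k hk (x k) (hx k (by omega)) (x (k + 1)) (hx (k + 1) hk)
      obtain rfl := h1.unique hord
      rw [← List.take_append_getElem hk, wordPerm_append, wordPerm_singleton, ← mul_assoc]
      refine ⟨.snoc _ _ hred ?_, h2⟩
      by_contra hasc
      have s0 := hπ₀.strictMono.monotone (not_lt.1 hasc)
      have s1 := h1.strictMono (Fin.castSucc_lt_succ (i := ω[k]))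
      have s2 := h2.strictMono (Fin.castSucc_lt_succ (i := ω[k]))
      simp only [Equiv.Perm.mul_apply, sigma_castSucc, sigma_succ] at s0 s1 s2
      set s := π₀ (wordPerm (ω.take k) ω[k].castSucc)
      set t := π₀ (wordPerm (ω.take k) ω[k].succ)
      exact affine_no_two_sign_changes (c := a t - a s) (m := b t - b s)
        (htan.monotoneOn (hrange 0 (by omega)) (hrange k (by omega)) (hx0 k (by omega)))
        (htan (hrange k (by omega)) (hrange (k + 1) hk) (hxlt k hk))
        (by linarith) (by linarith) (by linarith)
  simpa using (main ω.length le_rfl).1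

end CESPartition

theorem mainTheorem5 (n : ℕ) (p₀ p₁ p₂ : Fin (n + 1) → ℝ)
    (hp₀ : ∀ t, 0 < p₀ t) (hp₁ : ∀ t, 0 < p₁ t) (hp₂ : ∀ t, 0 < p₂ t)
    (ρ ρ₁ ρ₂ : ℝ) (hρ : ρ ∈ CESPartition.paramRange)
    (hρ₁ : ρ₁ ∈ CESPartition.paramRange) (hρ₂ : ρ₂ ∈ CESPartition.paramRange)
    (ε ε₁ ε₂ : ℝ) (hε : CESPartition.EpsAdmissible ε ρ p₀ p₁ p₂)
    (hε₁ : CESPartition.EpsAdmissible ε₁ ρ₁ p₀ p₁ p₂)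
    (hε₂ : CESPartition.EpsAdmissible ε₂ ρ₂ p₀ p₁ p₂)
    (S : Equiv.Perm (Fin (n + 1)))
    (hS₁ : StrictMono (CESPartition.ptilde ε ρ p₀ p₁))
    (hS₂ : StrictMono fun k => CESPartition.ptilde ε ρ p₀ p₂ (S k))
    (hgen₁ : CESPartition.GeneralPosition
      (CESPartition.ptilde ε₁ ρ₁ p₀ p₁) (CESPartition.ptilde ε₁ ρ₁ p₀ p₂))
    (hgen₂ : CESPartition.GeneralPosition
      (CESPartition.ptilde ε₂ ρ₂ p₀ p₁) (CESPartition.ptilde ε₂ ρ₂ p₀ p₂))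
    (ω₁ ω₂ : List (Fin n))
    (hω₁ : CESPartition.IsFormalWord
      (CESPartition.ptilde ε₁ ρ₁ p₀ p₁) (CESPartition.ptilde ε₁ ρ₁ p₀ p₂) ω₁)
    (hω₂ : CESPartition.IsFormalWord
      (CESPartition.ptilde ε₂ ρ₂ p₀ p₁) (CESPartition.ptilde ε₂ ρ₂ p₀ p₂) ω₂)
    (hperm₁ : CESPartition.wordPerm ω₁ = S) (hperm₂ : CESPartition.wordPerm ω₂ = S) :
    Relation.ReflTransGen CESPartition.BraidMove ω₁ ω₂ := by
  exact hω₁.isReduced.braid_equivalent hω₂.isReduced (hperm₁.trans hperm₂.symm)
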